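/- For positive integers $r,s,n$ put $\sigma_r(n)=\sum_{d\mid n}d^r$, set $\sigma_r(x)=0$ if $x$ is not a positive integer, and write $\sigma=\sigma_1$. For positive integers $a,b$ let $$W^{r,s}_{a,b}(n)=\sum_{\substack{l,m\ge 1\\ al+bm=n}}\sigma_r(l)\,\sigma_s(m).$$ Let $M_w(N)$ be the finite-dimensional complex vector space of holomorphic modular forms of weight $w$ on $\Gamma_0(N)$ (trivial character), let $\lambda_w(N)$ be its dimension, and let $B_k$ be the $k$-th Bernoulli number. Theorem. Let $k\ge 4$ be an even integer and let $a,b$ be positive integers with $\gcd(a,b)=1$. Let $f_i$ $(1\le i\le\lambda_{k+2}(ab))$ be a basis of $M_{k+2}(ab)$ and $h_i$ $(1\le i\le\lambda_{k+4}(ab))$ a basis of $M_{k+4}(ab)$, and let $a_i(n)$ and $c_i(n)$ denote the $n$-th Fourier coefficients of $f_i$ and $h_i$, respectively (the coefficients of $q^n$, $q=e^{2\pi i z}$). Then there exist constants $\gamma_i\in\mathbb{C}$ $(1\le i\le\lambda_{k+4}(ab))$, independent of $n$, such that for all $n\ge 2$ $$\sum_{\substack{l,m\ge 1\\ al+bm=n}}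 l\,\sigma(l)\,\sigma_{k-1}(m)=\frac{6n^2-a(k+1)n}{12a^2(k+1)(k+2)}\,\sigma_{k-1}(n/b)+\frac{B_k}{2a(k+2)}\,n\,\sigma(n/a)+\frac{2n}{a(k+2)}\,W^{1,k-1}_{a,b}(n)+\frac{B_k}{4a^2k(k+1)(k+2)}\sum_{i=1}^{\lambda_{k+4}(ab)}\gamma_i\,c_i(n).$$ Here $W^{1,k-1}_{a,b}(n)$ is given as follows: there exist constants $\alpha_i\in\mathbb{C}$ $(1\le i\le\lambda_{k+2}(ab))$, independent of $n$, such that for all $n\ge 1$ $$W^{1,k-1}_{a,b}(n)=\frac{B_k}{2k}\,\sigma(n/a)+\Big(\frac1{24}-\frac{n}{2ka}\Big)\sigma_{k-1}(n/b)-\frac{B_k}{4ak^2}\sum_{i=1}^{\lambda_{k+2}(ab)}\alpha_i\,a_i(n).$$ -/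

import Mathlib

open scoped MatrixGroups

noncomputable section

/-- The space `M_k(N)` of holomorphic modular forms of integral weight `k` on `Γ₀(N)`
(with trivial character), as a complex vector space. -/
abbrev ModForms (k : ℤ) (N : ℕ) : Type :=
  ModularForm (CongruenceSubgroup.Gamma0 N : Subgroup (GL (Fin 2) ℝ)) k

/-- The dimension `λ_k(N)` of `M_k(N)` over `ℂ`. -/
def dimModForms (k : ℤ) (N : ℕ) : ℕ := Module.finrank ℂ (ModForms k N)

/-- The `n`-th Fourier coefficient of `f ∈ M_k(N)`, i.e. the coefficient of `q ^ n` in the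
expansion of `f` in powers of `q = exp (2 π i z)`. -/
def modFormCoeff {k : ℤ} {N : ℕ} (f : ModForms k N) (n : ℕ) : ℂ :=
  (UpperHalfPlane.qExpansion 1 f).coeff n

/-- `sigmaDiv r n a` is `σ_r(n/a)`, with the convention that it is `0` if `n/a` is not a
positive integer (Mathlib's `σ_r` vanishes at `0`). -/
def sigmaDiv (r n a : ℕ) : ℕ :=
  if a ∣ n then ArithmeticFunction.sigma r (n / a) else 0

/-- The pairs of positive integers `(l, m)` with `a l + b m = n` (for `a, b` positive, every such
pair has `l, m ≤ n`). -/
def convPairs (a b n : ℕ) : Finset (ℕ × ℕ) :=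
  (Finset.Icc 1 n ×ˢ Finset.Icc 1 n).filter fun p => a * p.1 + b * p.2 = n

/-- The convolution sum `W_{a,b}^{r,s}(n) = ∑_{a l + b m = n} σ_r(l) σ_s(m)`. -/
def convW (a b r s n : ℕ) : ℕ :=
  ∑ p ∈ convPairs a b n, ArithmeticFunction.sigma r p.1 * ArithmeticFunction.sigma s p.2

/-- The convolution sum `W_{a,b}^{e;r,s}(n) = ∑_{a l + b m = n} l ^ e σ_r(l) σ_s(m)`. -/
def convWPow (a b e r s n : ℕ) : ℕ :=
  ∑ p ∈ convPairs a b n,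
    p.1 ^ e * ArithmeticFunction.sigma r p.1 * ArithmeticFunction.sigma s p.2

/-- For positive `a` and `b`, `convPairs a b n` consists of all the pairs of positive integers
`(l, m)` with `a l + b m = n`. -/
theorem mem_convPairs {a b n : ℕ} (ha : 0 < a) (hb : 0 < b) (p : ℕ × ℕ) :
    p ∈ convPairs a b n ↔ 0 < p.1 ∧ 0 < p.2 ∧ a * p.1 + b * p.2 = n := by
  simp only [convPairs, Finset.mem_filter, Finset.mem_product, Finset.mem_Icc]
  constructor
  · rintro ⟨⟨⟨h1, -⟩, h2, -⟩, h⟩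
    exact ⟨h1, h2, h⟩
  · rintro ⟨h1, h2, h⟩
    have h3 := Nat.le_mul_of_pos_left p.1 ha
    have h4 := Nat.le_mul_of_pos_left p.2 hb
    exact ⟨⟨⟨h1, by omega⟩, h2, by omega⟩, h⟩

end

/-! ### Convergent q-series on the upper half plane. -/

section QExpansions

open UpperHalfPlane hiding I
open Complex Derivative Filter
open scoped Manifold Topology Real

/-! Put φ(z) = E₂(az) and g(z) = E_k(bz). The coefficients of φg, D(φg), Dφ·g and D²g contain W, nW,
∑ l σ(l) σ_{k-1}(m) and n² σ_{k-1}(n/b) respectively. None of these functions is modular on its own,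
but two combinations are, of weights k+2 and k+4 on Γ₀(ab): aφg − (12/k)Dg and a(k+1)(k+2)Dφ·g −
2a(k+1)D(φg) + 12D²g (`isGamma0Form_mul_add_deriv`, `isGamma0Form_bracket`). Expanding them in the
given bases and comparing n-th coefficients gives linear equations that are solved for the two
convolution sums.

Modularity comes from three sources: ψ = aφ − E₂ has weight 2, since the defects of both terms
agree; the Serre derivative raises the weight by 2; and DE₂ − E₂²/12 has weight 4. Each combination
is a polynomial in such forms from which E₂ cancels. -/

/-- `F` is given on the whole upper half plane by the convergent series `∑ c n * q ^ n`. -/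
def HasQExpansion (F : ℍ → ℂ) (c : ℕ → ℂ) : Prop :=
  ∀ τ : ℍ, HasSum (fun n ↦ c n • Function.Periodic.qParam 1 τ ^ n) (F τ)

namespace HasQExpansion

variable {F G : ℍ → ℂ} {c d : ℕ → ℂ}

theorem add (hF : HasQExpansion F c) (hG : HasQExpansion G d) :
    HasQExpansion (F + G) (c + d) := fun τ ↦ by
  simpa [add_mul] using (hF τ).add (hG τ)

theorem const_smul (r : ℂ) (hF : HasQExpansion F c) : HasQExpansion (r • F) (r • c) := fun τ ↦ by
  simpa [mul_assoc] using (hF τ).mul_left r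

theorem mul (hF : HasQExpansion F c) (hG : HasQExpansion G d) :
    HasQExpansion (F * G) (fun n ↦ ∑ p ∈ Finset.HasAntidiagonal.antidiagonal n, c p.1 * d p.2) := fun τ ↦ by
  have h := summable_norm_sum_mul_antidiagonal_of_summable_norm
    (hF τ).summable.norm (hG τ).summable.norm
  have h2 := tsum_mul_tsum_eq_tsum_sum_antidiagonal_of_summable_norm
    (hF τ).summable.norm (hG τ).summable.norm
  rw [(hF τ).tsum_eq, (hG τ).tsum_eq] at h2
  rw [Pi.mul_apply, h2]
  convert! h.of_norm.hasSum using 2 with n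
  rw [smul_eq_mul, Finset.sum_mul]
  refine Finset.sum_congr rfl fun p hp ↦ ?_
  rw [← Finset.HasAntidiagonal.mem_antidiagonal.mp hp, pow_add]
  simp only [smul_eq_mul]
  ring

theorem sum {ι : Type*} (s : Finset ι) {F : ι → ℍ → ℂ} {c : ι → ℕ → ℂ}
    (h : ∀ i ∈ s, HasQExpansion (F i) (c i)) :
    HasQExpansion (∑ i ∈ s, F i) (∑ i ∈ s, c i) := fun τ ↦ by
  simpa [Finset.sum_mul] using hasSum_sum fun i hi ↦ h i hi τ

theorem normalizedDeriv (hF : HasQExpansion F c) :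
    HasQExpansion (D F) (fun n ↦ n * c n) := fun τ ↦ by
  -- Termwise differentiation on Im w > y, where the series is dominated by its absolutely
  -- convergent value at iy.
  set y : ℝ := τ.im / 2 with hy
  have hy0 : 0 < y := half_pos τ.im_pos
  have hyτ : y < (τ : ℂ).im := by simpa [hy] using τ.im_pos
  let σ : ℍ := ⟨y * I, by simpa using hy0⟩
  let U : Set ℂ := {w | y < w.im}
  have hU : IsOpen U := isOpen_lt continuous_const continuous_im
  have hτ : (τ : ℂ) ∈ U := hyτ
  have hsum := hasSum_deriv_of_summable_norm (U := U) (z := (τ : ℂ))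
    (F := fun n w ↦ c n • Function.Periodic.qParam 1 w ^ n) (hF σ).summable.norm
    (fun n ↦ by unfold Function.Periodic.qParam; fun_prop) hU
    (fun n w hw ↦ by
      simp only [smul_eq_mul, norm_mul, norm_pow, Function.Periodic.norm_qParam]
      have hw' : y < w.im := hw
      have : (σ : ℂ).im = y := by simp [σ]
      rw [this]
      gcongr ?_ * ?_ ^ n
      apply Real.exp_le_exp.mpr
      have := Real.pi_pos
      simp only [div_one]
      nlinarith) hτ
  have hfun : (fun w : ℂ ↦ ∑' n, c n • Function.Periodic.qParam 1 w ^ n) =ᶠ[𝓝 (τ : ℂ)]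
      F ∘ ofComplex := by
    filter_upwards [isOpen_upperHalfPlaneSet.mem_nhds τ.im_pos] with w hw
    have := (hF ⟨w, hw⟩).tsum_eq
    rw [Function.comp_apply, ofComplex_apply_of_im_pos hw]
    exact this
  rw [hfun.deriv_eq] at hsum
  have h := hsum.mul_left (2 * π * I)⁻¹
  unfold normalizedDerivOfComplex
  convert! h using 2 with n
  have hq : HasDerivAt (Function.Periodic.qParam 1)
      (Function.Periodic.qParam 1 (τ : ℂ) * (2 * π * I)) (τ : ℂ) := by
    unfold Function.Periodic.qParam
    have := ((hasDerivAt_id (τ : ℂ)).const_mul (2 * π * I)).cexp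
    simpa using this
  have := ((hq.pow n).const_smul (c n)).deriv
  have hpi : (2 * π * I : ℂ) ≠ 0 := two_pi_I_ne_zero
  simp only [smul_eq_mul] at this ⊢
  erw [this]
  rcases n with _ | n
  · simp
  · push_cast
    field_simp
    simp [pow_succ]
    ring

end HasQExpansion

/-- Cauchy's estimate on a disc of radius 1, which stays in the region of boundedness once Im z is
large. -/
theorem isBoundedAtImInfty_normalizedDeriv {F : ℍ → ℂ} (hF : MDiff F)
    (hb : IsBoundedAtImInfty F) : IsBoundedAtImInfty (D F) := by
  rw [isBoundedAtImInfty_iff] at hb ⊢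
  obtain ⟨M, A, h⟩ := hb
  refine ⟨‖(2 * π * I : ℂ)⁻¹‖ * (M / 1), max A 1 + 1, fun z hz ↦ ?_⟩
  have hball : Metric.closedBall (z : ℂ) 1 ⊆ {w | max A 1 ≤ w.im} := fun w hw ↦ by
    have h1 : |(w - z).im| ≤ 1 :=
      (abs_im_le_norm _).trans (by simpa [dist_eq_norm] using hw)
    have h2 := (abs_le.mp h1).1
    simp only [sub_im, coe_im] at h2
    simp only [Set.mem_ofPred_eq]
    linarith
  have hpos : ∀ w ∈ Metric.closedBall (z : ℂ) 1, 0 < w.im := fun w hw ↦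
    lt_of_lt_of_le (lt_of_lt_of_le one_pos (le_max_right _ _)) (hball hw)
  rw [UpperHalfPlane.mdifferentiable_iff] at hF
  simp only [normalizedDerivOfComplex, norm_mul]
  gcongr
  refine norm_deriv_le_of_forall_mem_sphere_norm_le one_pos ?_ fun w hw ↦ ?_
  · refine DifferentiableOn.diffContOnCl ?_
    rw [closure_ball _ one_ne_zero]
    exact hF.mono hpos
  · have hw' := Metric.sphere_subset_closedBall hw
    rw [Function.comp_apply, ofComplex_apply_of_im_pos (hpos w hw')]
    exact h _ ((le_max_left _ _).trans (hball hw'))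

end QExpansions

/-! ### Closure properties of modular forms on Γ₀(N). -/

section Gamma0Forms

open UpperHalfPlane hiding I
open Complex Derivative Filter Matrix
open scoped Manifold Topology Real ModularForm

/-- `F` is a holomorphic modular form of weight `k` on `Γ₀(N)`. -/
structure IsGamma0Form (N : ℕ) (k : ℤ) (F : ℍ → ℂ) : Prop where
  holo : MDiff F
  slash_eq : ∀ γ ∈ CongruenceSubgroup.Gamma0 N, F ∣[k] γ = F
  bdd : ∀ γ : SL(2, ℤ), IsBoundedAtImInfty (F ∣[k] γ)

namespace IsGamma0Form

variable {N M : ℕ} {k l : ℤ} {F G : ℍ → ℂ}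

/-- The element of `M_k(N)` with underlying function `F`. -/
def toModForms [NeZero N] (h : IsGamma0Form N k F) : ModForms k N where
  toFun := F
  slash_action_eq' := by
    rintro _ ⟨γ, hγ, rfl⟩
    exact h.slash_eq γ hγ
  holo' := h.holo
  bdd_at_cusps' {c} hc := by
    rw [Subgroup.IsArithmetic.isCusp_iff_isCusp_SL2Z] at hc
    exact (OnePoint.isBoundedAt_iff_forall_SL2Z hc).mpr fun γ _ ↦ h.bdd γ

@[simp]
theorem coe_toModForms [NeZero N] (h : IsGamma0Form N k F) : ⇑h.toModForms = F := rfl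

theorem of_levelOne (f : ModularForm 𝒮ℒ k) : IsGamma0Form N k f where
  holo := f.holo'
  slash_eq γ _ := f.slash_action_eq' _ ⟨γ, rfl⟩
  bdd γ := by
    have : (f : ℍ → ℂ) ∣[k] γ = f := f.slash_action_eq' _ ⟨γ, rfl⟩
    rw [this]
    exact ModularFormClass.bdd_at_infty f

theorem of_dvd (hNM : N ∣ M) (h : IsGamma0Form N k F) : IsGamma0Form M k F where
  holo := h.holo
  slash_eq γ hγ := h.slash_eq γ <| by
    rw [CongruenceSubgroup.Gamma0_mem, ZMod.intCast_zmod_eq_zero_iff_dvd] at hγ ⊢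
    exact (Int.natCast_dvd_natCast.mpr hNM).trans hγ
  bdd := h.bdd

theorem add (hF : IsGamma0Form N k F) (hG : IsGamma0Form N k G) : IsGamma0Form N k (F + G) where
  holo := hF.holo.add hG.holo
  slash_eq γ hγ := by rw [SlashAction.add_slash, hF.slash_eq γ hγ, hG.slash_eq γ hγ]
  bdd γ := by
    rw [SlashAction.add_slash]
    exact (hF.bdd γ).add (hG.bdd γ)

theorem const_smul (c : ℂ) (hF : IsGamma0Form N k F) : IsGamma0Form N k (c • F) where
  holo := hF.holo.const_smul c
  slash_eq γ hγ := by rw [ModularForm.SL_smul_slash, hF.slash_eq γ hγ]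
  bdd γ := by
    rw [ModularForm.SL_smul_slash]
    exact (hF.bdd γ).const_smul_left c

theorem mul (hF : IsGamma0Form N k F) (hG : IsGamma0Form N l G) :
    IsGamma0Form N (k + l) (F * G) where
  holo := hF.holo.mul hG.holo
  slash_eq γ hγ := by rw [ModularForm.mul_slash_SL2, hF.slash_eq γ hγ, hG.slash_eq γ hγ]
  bdd γ := by
    rw [ModularForm.mul_slash_SL2]
    exact (hF.bdd γ).mul (hG.bdd γ)

theorem serreDerivative (hF : IsGamma0Form N k F) :
    IsGamma0Form N (k + 2) (serreDerivative k F) where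
  holo := serreDerivative_mdifferentiable _ hF.holo
  slash_eq γ hγ := serreDerivative_slash_invariant hF.holo (hF.slash_eq γ hγ)
  bdd γ := by
    -- By equivariance, only the Serre derivative of `F ∣[k] γ` has to be bounded at i∞.
    rw [serreDerivative_slash_equivariant hF.holo]
    have hholo : MDiff (F ∣[k] γ) := hF.holo.slash k _
    have h := (EisensteinSeries.isBoundedAtImInfty_E2.mul (hF.bdd γ)).const_smul_left
      (-((k : ℂ) * 12⁻¹))
    convert! (isBoundedAtImInfty_normalizedDeriv hholo (hF.bdd γ)).add h using 1
    ext z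
    simp only [serreDerivative_apply, Pi.add_apply, Pi.smul_apply, Pi.mul_apply,
      smul_eq_mul]
    ring

end IsGamma0Form

/-- The matrix `diag(a, 1)`. -/
def scaleGL (K : Type*) [Field K] [CharZero K] (a : ℕ) [NeZero a] : GL (Fin 2) K :=
  GeneralLinearGroup.mkOfDetNeZero !![(a : K), 0; 0, 1] (by simp [NeZero.ne])

/-! ### The substitution z ↦ az. -/

section Scale

variable {a : ℕ} [NeZero a]

theorem coe_scaleGL (K : Type*) [Field K] [CharZero K] :
    (scaleGL K a).val = !![(a : K), 0; 0, 1] := rfl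

theorem det_scaleGL : (scaleGL ℝ a).det.val = a := by
  simp [coe_scaleGL]

theorem det_scaleGL_pos : 0 < (scaleGL ℝ a).det.val := by
  rw [det_scaleGL]
  exact_mod_cast NeZero.pos a

theorem coe_scaleGL_smul (τ : ℍ) : ((scaleGL ℝ a • τ : ℍ) : ℂ) = a * τ := by
  rw [coe_smul_of_det_pos det_scaleGL_pos]
  simp [num, denom, coe_scaleGL]

theorem slash_scaleGL (k : ℤ) (F : ℍ → ℂ) :
    F ∣[k] scaleGL ℝ a = (a : ℂ) ^ (k - 1) • fun τ ↦ F (scaleGL ℝ a • τ) := by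
  ext τ
  rw [ModularForm.slash_apply, det_scaleGL]
  have hσ : σ (scaleGL ℝ a) = ContinuousAlgEquiv.refl ℝ ℂ := if_pos det_scaleGL_pos
  simp [hσ, denom, coe_scaleGL, mul_comm]

theorem HasQExpansion.comp_scaleGL {F : ℍ → ℂ} {c : ℕ → ℂ} (hF : HasQExpansion F c) :
    HasQExpansion (fun τ ↦ F (scaleGL ℝ a • τ)) (fun n ↦ if a ∣ n then c (n / a) else 0) := by
  intro τ
  have hinj : Function.Injective (fun n : ℕ ↦ a * n) :=
    fun _ _ h ↦ Nat.eq_of_mul_eq_mul_left (NeZero.pos a) h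
  rw [← hinj.hasSum_iff]
  · convert! hF (scaleGL ℝ a • τ) using 2 with n
    simp only [Function.comp_apply, dvd_mul_right, if_true, smul_eq_mul]
    rw [Nat.mul_div_cancel_left _ (NeZero.pos a), pow_mul]
    congr 2
    unfold Function.Periodic.qParam
    rw [← Complex.exp_nat_mul, coe_scaleGL_smul]
    congr 1
    ring
  · intro n hn
    have : ¬ a ∣ n := by
      rintro ⟨m, rfl⟩
      exact hn ⟨m, rfl⟩
    simp [this]

/-- The image of ∞ under diag(a,1)γ is a rational cusp, hence δ∞ for some δ in SL₂(ℤ); then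
δ⁻¹diag(a,1)γ fixes ∞ and is upper triangular. Boundedness at every cusp thus survives z ↦ az. -/
theorem exists_scaleGL_mul_eq (γ : SL(2, ℤ)) :
    ∃ (δ : SL(2, ℤ)) (T : GL (Fin 2) ℝ), T 1 0 = 0 ∧
      scaleGL ℝ a * SpecialLinearGroup.mapGL ℝ γ = SpecialLinearGroup.mapGL ℝ δ * T := by
  obtain ⟨δ, hδ⟩ := OnePoint.exists_mem_SL2 ℤ
    ((scaleGL ℚ a * SpecialLinearGroup.mapGL ℚ γ) • (OnePoint.infty : OnePoint ℚ))
  set T : GL (Fin 2) ℚ :=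
    (SpecialLinearGroup.mapGL ℚ δ)⁻¹ * (scaleGL ℚ a * SpecialLinearGroup.mapGL ℚ γ) with hT
  have hT0 : T 1 0 = 0 := by
    rw [← OnePoint.smul_infty_eq_self_iff, hT, mul_smul, ← hδ, inv_smul_smul]
  have hmap (g : SL(2, ℤ)) : (SpecialLinearGroup.mapGL ℚ g).map (Rat.castHom ℝ) =
      SpecialLinearGroup.mapGL ℝ g := by
    ext i j
    simp
  have hscale : (scaleGL ℚ a).map (Rat.castHom ℝ) = scaleGL ℝ a := by
    ext i j
    fin_cases i <;> fin_cases j <;> simp [coe_scaleGL]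
  refine ⟨δ, T.map (Rat.castHom ℝ), ?_, ?_⟩
  · simp [hT0]
  · rw [← hmap γ, ← hmap δ, ← hscale, ← map_mul, ← map_mul, hT, mul_inv_cancel_left]

theorem isBoundedAtImInfty_slash_scaleGL {k : ℤ} {F : ℍ → ℂ}
    (hF : ∀ γ : SL(2, ℤ), IsBoundedAtImInfty (F ∣[k] γ)) (γ : SL(2, ℤ)) :
    IsBoundedAtImInfty ((F ∣[k] scaleGL ℝ a) ∣[k] γ) := by
  obtain ⟨δ, T, hT, h⟩ := exists_scaleGL_mul_eq (a := a) γ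
  rw [ModularForm.SL_slash, ← SlashAction.slash_mul]
  erw [h]
  rw [SlashAction.slash_mul]
  exact (hF δ).slash k hT

/-- Conjugation by diag(a,1) multiplies the upper right entry by a and divides the lower left one by
a. -/
theorem exists_scaleGL_mul_eq_of_mem_Gamma0 {N : ℕ} {γ : SL(2, ℤ)}
    (hγ : γ ∈ CongruenceSubgroup.Gamma0 (a * N)) :
    ∃ δ ∈ CongruenceSubgroup.Gamma0 N, a * δ 1 0 = γ 1 0 ∧ δ 1 1 = γ 1 1 ∧
      scaleGL ℝ a * SpecialLinearGroup.mapGL ℝ γ = SpecialLinearGroup.mapGL ℝ δ * scaleGL ℝ a := by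
  rw [CongruenceSubgroup.Gamma0_mem, ZMod.intCast_zmod_eq_zero_iff_dvd] at hγ
  obtain ⟨m, hm⟩ := hγ
  have hdet := γ.det_coe
  rw [det_fin_two, hm] at hdet
  obtain ⟨δ, hδ⟩ : ∃ δ : SL(2, ℤ), δ.1 = !![γ 0 0, a * γ 0 1; N * m, γ 1 1] := by
    refine ⟨⟨_, ?_⟩, rfl⟩
    rw [det_fin_two_of]
    push_cast at hdet
    linarith
  have h10 : a * δ 1 0 = γ 1 0 := by
    rw [hm, hδ]
    push_cast
    exact (mul_assoc _ _ _).symm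
  refine ⟨δ, ?_, h10, by rw [hδ]; rfl, ?_⟩
  · rw [CongruenceSubgroup.Gamma0_mem, ZMod.intCast_zmod_eq_zero_iff_dvd, hδ]
    exact dvd_mul_right _ _
  · ext i j
    fin_cases i <;> fin_cases j <;>
      simp [coe_scaleGL, Matrix.mul_apply, Fin.sum_univ_two, hδ, hm, mul_comm, mul_left_comm]

theorem IsGamma0Form.slash_scaleGL {N : ℕ} {k : ℤ} {F : ℍ → ℂ} (hF : IsGamma0Form N k F) :
    IsGamma0Form (a * N) k (F ∣[k] scaleGL ℝ a) where
  holo := hF.holo.slash k _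
  slash_eq γ hγ := by
    obtain ⟨δ, hδ, -, -, h⟩ := exists_scaleGL_mul_eq_of_mem_Gamma0 hγ
    rw [ModularForm.SL_slash, ← SlashAction.slash_mul]
    erw [h]
    rw [SlashAction.slash_mul]
    congr 1
    exact hF.slash_eq δ hδ
  bdd := isBoundedAtImInfty_slash_scaleGL hF.bdd

end Scale

/-! ### Quasimodularity of E₂. -/

open EisensteinSeries in
theorem E2_slash_apply (γ : SL(2, ℤ)) (z : ℍ) :
    (E2 ∣[(2 : ℤ)] γ) z = E2 z + 12 * ((2 * π * I)⁻¹ * (γ 1 0 / denom γ z)) := by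
  have hπ : (π : ℂ) ≠ 0 := by exact_mod_cast Real.pi_ne_zero
  rw [E2_slash_action, Pi.sub_apply, Pi.smul_apply, D2, smul_eq_mul, riemannZeta_two]
  have hI : (2 * π * I : ℂ)⁻¹ = -I / (2 * π) := by
    field_simp
    simp
  rw [hI]
  field_simp
  ring

theorem isBoundedAtImInfty_div_denom (γ : SL(2, ℤ)) :
    IsBoundedAtImInfty (fun z : ℍ ↦ (γ 1 0 / denom γ z : ℂ)) := by
  rw [isBoundedAtImInfty_iff]
  refine ⟨1, 1, fun z hz ↦ ?_⟩
  rw [norm_div, div_le_one (norm_pos_iff.mpr (denom_ne_zero _ z))]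
  calc ‖((γ 1 0 : ℤ) : ℂ)‖ = |((γ 1 0 : ℤ) : ℝ)| * 1 := by simp
    _ ≤ |((γ 1 0 : ℤ) : ℝ)| * z.im := by gcongr
    _ = |(denom γ z).im| := by
      simp [ModularGroup.denom_apply, abs_mul, abs_of_pos z.im_pos]
    _ ≤ _ := abs_im_le_norm _

open EisensteinSeries in
theorem isBoundedAtImInfty_E2_slash (γ : SL(2, ℤ)) : IsBoundedAtImInfty (E2 ∣[(2 : ℤ)] γ) := by
  have h := isBoundedAtImInfty_E2.add
    ((isBoundedAtImInfty_div_denom γ).const_smul_left (12 * (2 * π * I : ℂ)⁻¹))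
  convert! h using 1
  ext z
  simp only [E2_slash_apply, Pi.add_apply, Pi.smul_apply, smul_eq_mul]
  ring

open EisensteinSeries in
/-- `a E₂(a z) - E₂(z)` is a modular form of weight `2` on `Γ₀(a)`. -/
theorem isGamma0Form_E2_slash_scaleGL_sub (a : ℕ) [NeZero a] :
    IsGamma0Form a 2 (E2 ∣[(2 : ℤ)] scaleGL ℝ a + (-1 : ℂ) • E2) where
  holo := (E2_mdifferentiable.slash 2 _).add (E2_mdifferentiable.const_smul _)
  slash_eq γ hγ := by
    rw [← mul_one a] at hγ
    obtain ⟨δ, -, h10, h11, h⟩ := exists_scaleGL_mul_eq_of_mem_Gamma0 hγ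
    have h2 : (E2 ∣[(2 : ℤ)] scaleGL ℝ a) ∣[(2 : ℤ)] γ = (E2 ∣[(2 : ℤ)] δ) ∣[(2 : ℤ)] scaleGL ℝ a := by
      rw [ModularForm.SL_slash, ← SlashAction.slash_mul]
      erw [h]
      rw [SlashAction.slash_mul]
      rfl
    rw [SlashAction.add_slash, ModularForm.SL_smul_slash, h2]
    ext z
    -- The defect of aE₂(az) is a(c/a)/(cz+d), the same as that of E₂, so the difference has none.
    have hd : denom δ (scaleGL ℝ a • z : ℍ) = denom γ z := by
      rw [ModularGroup.denom_apply, ModularGroup.denom_apply, coe_scaleGL_smul, h11, ← h10]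
      push_cast
      ring
    simp only [slash_scaleGL, Pi.add_apply, Pi.smul_apply, smul_eq_mul, E2_slash_apply, hd, ← h10]
    push_cast
    norm_num
    ring
  bdd γ := by
    rw [SlashAction.add_slash, ModularForm.SL_smul_slash]
    exact (isBoundedAtImInfty_slash_scaleGL isBoundedAtImInfty_E2_slash γ).add
      ((isBoundedAtImInfty_E2_slash γ).const_smul_left _)

open EisensteinSeries in
/-- `D E₂ - E₂² / 12` is a modular form of weight `4`. -/
theorem isGamma0Form_serreDerivative_one_E2 (N : ℕ) :
    IsGamma0Form N 4 (serreDerivative 1 E2) := by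
  have hslash (γ : SL(2, ℤ)) : serreDerivative 1 E2 ∣[(4 : ℤ)] γ = serreDerivative 1 E2 := by
    have hdecomp : serreDerivative 1 E2 = D E2 + (-12⁻¹ : ℂ) • (E2 * E2) := by
      ext z
      simp only [serreDerivative_apply, Pi.add_apply, Pi.smul_apply, Pi.mul_apply, smul_eq_mul]
      ring
    have hmul : (E2 * E2) ∣[(4 : ℤ)] γ = E2 ∣[(2 : ℤ)] γ * E2 ∣[(2 : ℤ)] γ :=
      ModularForm.mul_slash_SL2 2 2 γ E2 E2
    have hD := normalizedDerivOfComplex_SL_slash (k := 2) E2_mdifferentiable (γ := γ)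
    rw [hdecomp, SlashAction.add_slash, ModularForm.SL_smul_slash, hmul]
    ext z
    have hDz := congrFun hD z
    -- With j = c/(2πi(cz+d)), the defect of E₂ is 12j and Dj = −j². Comparing this direct
    -- computation with the general formula for D of a slash gives the transformation of DE₂; its
    -- defect cancels that of E₂²/12. Hence the Serre index 1 in place of the weight 2.
    have hderiv : D (E2 ∣[(2 : ℤ)] γ) z =
        D E2 z - 12 * ((2 * π * I)⁻¹ * (γ 1 0 / denom γ z)) ^ 2 := by
      have hden : HasDerivAt (fun w : ℂ ↦ denom γ w) (γ 1 0 : ℂ) (z : ℂ) := by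
        simpa [denom] using ((hasDerivAt_id (z : ℂ)).const_mul (γ 1 0 : ℂ)).add_const (γ 1 1 : ℂ)
      have hz := denom_ne_zero (γ : GL (Fin 2) ℝ) z
      have hE2 := (UpperHalfPlane.mdifferentiableAt_iff.mp (E2_mdifferentiable z)).hasDerivAt
      have hsum := hE2.add ((hden.inv hz).const_mul (12 * ((2 * π * I)⁻¹ * (γ 1 0 : ℂ))))
      have heq : (E2 ∣[(2 : ℤ)] γ) ∘ ofComplex =ᶠ[𝓝 (z : ℂ)] E2 ∘ ofComplex +
          fun w ↦ 12 * ((2 * π * I)⁻¹ * (γ 1 0 : ℂ)) * (denom γ w)⁻¹ := by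
        filter_upwards [isOpen_upperHalfPlaneSet.mem_nhds z.im_pos] with w hw
        simp only [Function.comp_apply, Pi.add_apply, E2_slash_apply,
          ofComplex_apply_of_im_pos hw]
        ring
      unfold normalizedDerivOfComplex
      rw [heq.deriv_eq]
      erw [hsum.deriv]
      field_simp
      ring
    rw [hderiv, Pi.sub_apply] at hDz
    simp only [E2_slash_apply, Pi.add_apply, Pi.smul_apply, Pi.mul_apply, smul_eq_mul] at hDz ⊢
    have h4 : (2 : ℤ) + 2 = 4 := rfl
    rw [h4] at hDz
    push_cast at hDz
    linear_combination -hDz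
  refine ⟨serreDerivative_mdifferentiable _ E2_mdifferentiable, fun γ _ ↦ hslash γ, fun γ ↦ ?_⟩
  rw [hslash]
  have h := (isBoundedAtImInfty_normalizedDeriv E2_mdifferentiable isBoundedAtImInfty_E2).add
    ((isBoundedAtImInfty_E2.mul isBoundedAtImInfty_E2).const_smul_left (-12⁻¹ : ℂ))
  convert! h using 1
  ext z
  simp only [serreDerivative_apply, Pi.add_apply, Pi.smul_apply, Pi.mul_apply, smul_eq_mul]
  ring

end Gamma0Forms

/-! ### Fourier coefficients and convolution sums. -/

section Coefficients

theorem hasQExpansion_modForms {N : ℕ} [NeZero N] {k : ℤ} (f : ModForms k N) :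
    HasQExpansion f (modFormCoeff f) := fun τ ↦ by
  have hper : (1 : ℝ) ∈
      (CongruenceSubgroup.Gamma0 N : Subgroup (GL (Fin 2) ℝ)).strictPeriods := by simp
  have : Fact (IsCusp OnePoint.infty (CongruenceSubgroup.Gamma0 N : Subgroup (GL (Fin 2) ℝ))) :=
    ⟨Subgroup.isCusp_of_mem_strictPeriods one_pos hper⟩
  exact ModularForm.hasSum_qExpansion _ one_pos hper τ

theorem HasQExpansion.modFormCoeff_eq {N : ℕ} {k : ℤ} {f : ModForms k N} {c : ℕ → ℂ}
    (hf : HasQExpansion f c) (n : ℕ) : c n = modFormCoeff f n :=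
  ModularFormClass.qExpansion_coeff_unique one_pos (by simp) hf n

theorem IsGamma0Form.exists_sum_basis_eq {N : ℕ} [NeZero N] {k : ℤ} {F : UpperHalfPlane → ℂ}
    (hF : IsGamma0Form N k F) {c : ℕ → ℂ} (hc : HasQExpansion F c) {ι : Type*} [Fintype ι]
    (v : Module.Basis ι ℂ (ModForms k N)) :
    ∃ β : ι → ℂ, ∀ n, c n = ∑ i, β i * modFormCoeff (v i) n := by
  refine ⟨v.repr hF.toModForms, fun n ↦ ?_⟩
  have hc' : HasQExpansion hF.toModForms c := hc
  have hsum : HasQExpansion hF.toModForms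
      (∑ i, v.repr hF.toModForms i • modFormCoeff (v i)) := by
    have h := HasQExpansion.sum Finset.univ fun i _ ↦
      (hasQExpansion_modForms (v i)).const_smul (v.repr hF.toModForms i)
    have hcoe := congrArg (fun f : ModForms k N ↦ (f : UpperHalfPlane → ℂ))
      (v.sum_repr hF.toModForms).symm
    convert! h using 1
    exact hcoe.trans (by ext z; simp [-Module.Basis.sum_repr])
  rw [hc'.modFormCoeff_eq, ← hsum.modFormCoeff_eq]
  simp

theorem sum_antidiagonal_ite_mul (f : ℕ → ℂ) (n : ℕ) :
    ∑ p ∈ Finset.HasAntidiagonal.antidiagonal n, (if p.1 = 0 then 1 else 0) * f p.2 = f n := by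
  rw [Finset.sum_eq_single (0, n)]
  · simp
  · rintro ⟨i, j⟩ hp hne
    have hi : i ≠ 0 := by
      rintro rfl
      simp at hp
      exact hne (by rw [hp])
    simp [hi]
  · simp

theorem sum_antidiagonal_mul_ite (f : ℕ → ℂ) (n : ℕ) :
    ∑ p ∈ Finset.HasAntidiagonal.antidiagonal n, f p.1 * (if p.2 = 0 then 1 else 0) = f n := by
  rw [Finset.sum_eq_single (n, 0)]
  · simp
  · rintro ⟨i, j⟩ hp hne
    have hj : j ≠ 0 := by
      rintro rfl
      simp at hp
      exact hne (by rw [hp])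
    simp [hj]
  · simp

theorem sigmaDiv_zero (r a : ℕ) : sigmaDiv r 0 a = 0 := by simp [sigmaDiv]

/-- Reindexing by (l, m) ↦ (al, bm); pairs outside the image contribute 0. The weight `w` is 1 for W
and the identity for the sum twisted by l. -/
theorem sum_antidiagonal_sigmaDiv {a b : ℕ} (ha : 0 < a) (hb : 0 < b) (w : ℕ → ℂ) (r s n : ℕ) :
    ∑ p ∈ Finset.HasAntidiagonal.antidiagonal n,
        w p.1 * sigmaDiv r p.1 a * sigmaDiv s p.2 b =
      ∑ p ∈ convPairs a b n, w (a * p.1) *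
        (ArithmeticFunction.sigma r p.1 : ℂ) * (ArithmeticFunction.sigma s p.2 : ℂ) := by
  symm
  refine Finset.sum_of_injOn (fun p ↦ (a * p.1, b * p.2)) ?_ ?_ ?_ ?_
  · rintro ⟨l, m⟩ - ⟨l', m'⟩ - h
    simp only [Prod.mk.injEq] at h ⊢
    exact ⟨Nat.eq_of_mul_eq_mul_left ha h.1, Nat.eq_of_mul_eq_mul_left hb h.2⟩
  · intro p hp
    have := (mem_convPairs ha hb p).mp hp
    simpa using this.2.2
  · rintro ⟨i, j⟩ hp hne
    by_cases hai : a ∣ i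
    · by_cases hbj : b ∣ j
      · obtain ⟨l, rfl⟩ := hai
        obtain ⟨m, rfl⟩ := hbj
        rcases Nat.eq_zero_or_pos l with rfl | hl
        · simp [sigmaDiv_zero]
        rcases Nat.eq_zero_or_pos m with rfl | hm
        · simp [sigmaDiv_zero]
        refine absurd ⟨(l, m), (mem_convPairs ha hb _).mpr ⟨hl, hm, ?_⟩, rfl⟩ hne
        simpa using hp
      · simp [sigmaDiv, hbj]
    · simp [sigmaDiv, hai]
  · rintro ⟨l, m⟩ -
    simp [sigmaDiv, Nat.mul_div_cancel_left _ ha, Nat.mul_div_cancel_left _ hb]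

theorem sum_antidiagonal_sigmaDiv_mul {a b : ℕ} (ha : 0 < a) (hb : 0 < b) (r s n : ℕ) :
    ∑ p ∈ Finset.HasAntidiagonal.antidiagonal n, (sigmaDiv r p.1 a : ℂ) * sigmaDiv s p.2 b =
      convW a b r s n := by
  simpa [convW] using sum_antidiagonal_sigmaDiv ha hb 1 r s n

theorem sum_antidiagonal_mul_sigmaDiv_mul {a b : ℕ} (ha : 0 < a) (hb : 0 < b) (r s n : ℕ) :
    ∑ p ∈ Finset.HasAntidiagonal.antidiagonal n,
        (p.1 : ℂ) * sigmaDiv r p.1 a * sigmaDiv s p.2 b = a * convWPow a b 1 r s n := by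
  rw [sum_antidiagonal_sigmaDiv ha hb (fun i ↦ (i : ℂ)) r s n]
  simp only [convWPow, Nat.cast_sum, Finset.mul_sum]
  refine Finset.sum_congr rfl fun p _ ↦ ?_
  push_cast
  ring

/-- The `q`-expansion coefficients of `1 + t ∑ σ_r(n) q ^ (a n)`. -/
noncomputable def eisensteinCoeff (t : ℂ) (r a n : ℕ) : ℂ := (if n = 0 then 1 else 0) + t * sigmaDiv r n a

theorem mul_eisensteinCoeff (t : ℂ) (r a n : ℕ) :
    n * eisensteinCoeff t r a n = t * (n * sigmaDiv r n a) := by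
  rcases eq_or_ne n 0 with rfl | hn
  · simp
  · simp [eisensteinCoeff, hn]
    ring

theorem eisensteinCoeff_of_pos (t : ℂ) (r a : ℕ) {n : ℕ} (hn : 0 < n) :
    eisensteinCoeff t r a n = t * sigmaDiv r n a := by
  simp [eisensteinCoeff, hn.ne']

theorem sum_antidiagonal_eisensteinCoeff_mul {a b : ℕ} (ha : 0 < a) (hb : 0 < b) (u t : ℂ)
    (r s : ℕ) {n : ℕ} (hn : 0 < n) :
    ∑ p ∈ Finset.HasAntidiagonal.antidiagonal n,
        eisensteinCoeff u r a p.1 * eisensteinCoeff t s b p.2 =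
      u * sigmaDiv r n a + t * sigmaDiv s n b + u * t * convW a b r s n := by
  have h (p : ℕ × ℕ) : eisensteinCoeff u r a p.1 * eisensteinCoeff t s b p.2 =
      (if p.1 = 0 then 1 else 0) * eisensteinCoeff t s b p.2 +
      u * ((sigmaDiv r p.1 a : ℂ) * (if p.2 = 0 then 1 else 0)) +
      u * t * ((sigmaDiv r p.1 a : ℂ) * sigmaDiv s p.2 b) := by
    simp only [eisensteinCoeff]
    ring
  simp_rw [h, Finset.sum_add_distrib, ← Finset.mul_sum, sum_antidiagonal_sigmaDiv_mul ha hb,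
    sum_antidiagonal_ite_mul, sum_antidiagonal_mul_ite (fun i ↦ (sigmaDiv r i a : ℂ)),
    eisensteinCoeff_of_pos _ _ _ hn]
  ring

theorem sum_antidiagonal_mul_eisensteinCoeff_mul {a b : ℕ} (ha : 0 < a) (hb : 0 < b) (u t : ℂ)
    (r s n : ℕ) :
    ∑ p ∈ Finset.HasAntidiagonal.antidiagonal n,
        (p.1 * eisensteinCoeff u r a p.1) * eisensteinCoeff t s b p.2 =
      u * (n * sigmaDiv r n a) + u * t * (a * convWPow a b 1 r s n) := by
  have h (p : ℕ × ℕ) : (p.1 * eisensteinCoeff u r a p.1) * eisensteinCoeff t s b p.2 =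
      u * ((p.1 * (sigmaDiv r p.1 a : ℂ)) * (if p.2 = 0 then 1 else 0)) +
      u * t * (p.1 * (sigmaDiv r p.1 a : ℂ) * sigmaDiv s p.2 b) := by
    rw [mul_eisensteinCoeff]
    simp only [eisensteinCoeff]
    ring
  simp_rw [h, Finset.sum_add_distrib, ← Finset.mul_sum, sum_antidiagonal_mul_sigmaDiv_mul ha hb,
    sum_antidiagonal_mul_ite (fun i ↦ i * (sigmaDiv r i a : ℂ))]

theorem ite_dvd_eq_eisensteinCoeff {a : ℕ} (ha : 0 < a) (t : ℂ) (r n : ℕ) :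
    (if a ∣ n then
        (if n / a = 0 then 1 else t * (ArithmeticFunction.sigma r (n / a) : ℂ)) else 0) =
      eisensteinCoeff t r a n := by
  rcases Nat.eq_zero_or_pos n with rfl | hn
  · simp [eisensteinCoeff, sigmaDiv_zero]
  · rw [eisensteinCoeff_of_pos _ _ _ hn]
    by_cases h : a ∣ n
    · simp [sigmaDiv, h, (Nat.div_pos (Nat.le_of_dvd hn h) ha).ne']
    · simp [sigmaDiv, h]

end Coefficients

/-! ### The two modular combinations of E₂(az) and E_k(bz). -/

section EisensteinPair

open UpperHalfPlane hiding I
open Complex Derivative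
open scoped Manifold Real

variable {a b k : ℕ} [NeZero a] [NeZero b]

/-- The function `z ↦ E₂(a z)`. -/
noncomputable def scaledE2 (a : ℕ) [NeZero a] (τ : ℍ) : ℂ := EisensteinSeries.E2 (scaleGL ℝ a • τ)

/-- The function `z ↦ E_k(b z)`. -/
noncomputable def scaledE (hk : 3 ≤ k) (b : ℕ) [NeZero b] (τ : ℍ) : ℂ := ModularForm.E hk (scaleGL ℝ b • τ)

theorem hasQExpansion_scaledE2 : HasQExpansion (scaledE2 a) (eisensteinCoeff (-24) 1 a) := by
  have h : HasQExpansion EisensteinSeries.E2 _ := fun τ ↦ by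
    simpa only [Function.Periodic.qParam, ofReal_one, div_one] using
      EisensteinSeries.hasSum_qExpansion_E2 (z := τ)
  convert! h.comp_scaleGL (a := a) using 1
  ext n
  exact (ite_dvd_eq_eisensteinCoeff (NeZero.pos a) _ _ _).symm

theorem hasQExpansion_scaledE (hk : 3 ≤ k) (hk2 : Even k) :
    HasQExpansion (scaledE hk b) (eisensteinCoeff (-(2 * k / bernoulli k)) (k - 1) b) := by
  have h : HasQExpansion (ModularForm.E hk)
      (fun n ↦ (qExpansion 1 (ModularForm.E hk)).coeff n) := fun τ ↦ by
    have : Fact (IsCusp OnePoint.infty 𝒮ℒ) :=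
      ⟨Subgroup.isCusp_of_mem_strictPeriods one_pos (by simp)⟩
    exact ModularForm.hasSum_qExpansion _ one_pos (by simp) τ
  convert! h.comp_scaleGL (a := b) using 1
  ext n
  simp_rw [EisensteinSeries.E_qExpansion_coeff hk hk2]
  exact (ite_dvd_eq_eisensteinCoeff (NeZero.pos b) _ _ _).symm

theorem mdifferentiable_scaledE2 : MDiff (scaledE2 a) := by
  have h := (E2_mdifferentiable.slash 2 (scaleGL ℝ a)).const_smul (a : ℂ)⁻¹
  convert! h using 1
  ext τ
  have ha : (a : ℂ) ≠ 0 := Nat.cast_ne_zero.mpr (NeZero.ne a)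
  simp [slash_scaleGL, ha]
  rfl

theorem isGamma0Form_scaledE2_sub :
    IsGamma0Form a 2 ((a : ℂ) • scaledE2 a + (-1 : ℂ) • EisensteinSeries.E2) := by
  have h := isGamma0Form_E2_slash_scaleGL_sub a
  rw [slash_scaleGL] at h
  norm_num at h
  simpa using! h

theorem isGamma0Form_scaledE (hk : 3 ≤ k) : IsGamma0Form b k (scaledE hk b) := by
  have h := ((IsGamma0Form.of_levelOne (N := 1) (ModularForm.E hk)).slash_scaleGL
    (a := b)).const_smul ((b : ℂ) ^ ((k : ℤ) - 1))⁻¹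
  have hb : (b : ℂ) ^ ((k : ℤ) - 1) ≠ 0 := zpow_ne_zero _ (Nat.cast_ne_zero.mpr (NeZero.ne b))
  rw [slash_scaleGL, smul_smul, inv_mul_cancel₀ hb, one_smul, mul_one] at h
  exact h

/-- With ψ = tφ − E₂ and ∂ the Serre derivative, this is ψg − (12/k)∂g: the two E₂g terms cancel. -/
theorem isGamma0Form_mul_add_deriv {φ g : ℍ → ℂ} {N : ℕ} {t : ℂ} (hk : k ≠ 0)
    (hφ : IsGamma0Form N 2 (t • φ + (-1 : ℂ) • EisensteinSeries.E2))
    (hg : IsGamma0Form N k g) :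
    IsGamma0Form N (k + 2) (t • (φ * g) + (-(12 / k) : ℂ) • D g) := by
  have h1 := hφ.mul hg
  rw [add_comm (2 : ℤ)] at h1
  have h := h1.add (hg.serreDerivative.const_smul (-(12 / k)))
  convert! h using 1
  ext z
  have hk' : (k : ℂ) ≠ 0 := Nat.cast_ne_zero.mpr hk
  simp only [Pi.add_apply, Pi.smul_apply, Pi.mul_apply, smul_eq_mul, serreDerivative_apply]
  push_cast
  field_simp
  ring

/-- With ψ = tφ − E₂ and ∂ the Serre derivative, this is (k+1)(k ∂ψ·g − 2ψ ∂g) + 12 ∂²g + k(k+2)(DE₂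
− E₂²/12)g. The first summand is a multiple of the Rankin–Cohen bracket of ψ and g; the others
remove the DE₂·g and E₂·Dg it leaves. -/
theorem isGamma0Form_bracket {φ g : ℍ → ℂ} {N : ℕ} {t : ℂ} (hφ' : MDiff φ)
    (hφ : IsGamma0Form N 2 (t • φ + (-1 : ℂ) • EisensteinSeries.E2))
    (hg : IsGamma0Form N k g) :
    IsGamma0Form N (k + 4) ((t * (k + 1) * (k + 2)) • (D φ * g) +
      ((-2 * t * (k + 1)) • D (φ * g) + (12 : ℂ) • D (D g))) := by
  have h1 := (hφ.serreDerivative.mul hg).const_smul (k * (k + 1))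
  have h2 := (hφ.mul hg.serreDerivative).const_smul (-2 * (k + 1))
  have h3 := hg.serreDerivative.serreDerivative.const_smul 12
  have h4 := ((isGamma0Form_serreDerivative_one_E2 N).mul hg).const_smul (k * (k + 2))
  rw [show (2 : ℤ) + 2 + k = k + 4 by ring] at h1
  rw [show (2 : ℤ) + (k + 2) = k + 4 by ring] at h2
  rw [show (k : ℤ) + 2 + 2 = k + 4 by ring] at h3
  rw [show (4 : ℤ) + k = k + 4 by ring] at h4
  have h := ((h1.add h2).add h3).add h4
  convert! h using 1
  have hE := E2_mdifferentiable
  have hDg := normalizedDerivOfComplex_mdifferentiable hg.holo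
  have hD1 : D (φ * g) = D φ * g + φ * D g := normalizedDerivOfComplex_mul _ _ hφ' hg.holo
  have hD2 : D (t • φ + (-1 : ℂ) • EisensteinSeries.E2) =
      t • D φ + (-1 : ℂ) • D EisensteinSeries.E2 := by
    rw [normalizedDerivOfComplex_add _ _ (hφ'.const_smul _) (hE.const_smul _),
      normalizedDerivOfComplex_smul _ _ hφ', normalizedDerivOfComplex_smul _ _ hE]
  have hD3 : D (serreDerivative (k : ℤ) g) = D (D g) + (-((k : ℂ) * 12⁻¹)) •
      (D EisensteinSeries.E2 * g + EisensteinSeries.E2 * D g) := by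
    have : serreDerivative (k : ℤ) g = D g + (-((k : ℂ) * 12⁻¹)) • (EisensteinSeries.E2 * g) := by
      ext z
      simp only [serreDerivative_apply, Pi.add_apply, Pi.smul_apply, Pi.mul_apply, smul_eq_mul]
      push_cast
      ring
    rw [this, normalizedDerivOfComplex_add _ _ hDg ((hE.mul hg.holo).const_smul _),
      normalizedDerivOfComplex_smul _ _ (hE.mul hg.holo),
      normalizedDerivOfComplex_mul _ _ hE hg.holo]
  ext z
  simp only [hD1, Pi.add_apply, Pi.smul_apply, Pi.mul_apply, smul_eq_mul]
  rw [serreDerivative_apply, serreDerivative_apply (((k : ℤ) + 2 : ℤ) : ℂ), hD2, hD3]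
  simp only [serreDerivative_apply, Pi.add_apply, Pi.smul_apply, Pi.mul_apply, smul_eq_mul]
  push_cast
  ring

end EisensteinPair

/-- Euler's formula makes ζ(k) a multiple of the Bernoulli number, and ζ has no zero with real part
at least 1. -/
theorem bernoulli_ne_zero_of_even {k : ℕ} (hk : k ≠ 0) (hk2 : Even k) : bernoulli k ≠ 0 := by
  obtain ⟨m, rfl⟩ := hk2
  have hm : m ≠ 0 := by omega
  have hζ : riemannZeta (2 * m) ≠ 0 := riemannZeta_ne_zero_of_one_le_re (by
    have : 1 ≤ m := Nat.one_le_iff_ne_zero.mpr hm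
    have : (1 : ℝ) ≤ m := by exact_mod_cast this
    simp
    linarith)
  intro h
  rw [riemannZeta_two_mul_nat hm, ← two_mul] at *
  simp [h] at hζ

theorem theorem3p1 (k a b : ℕ) (hk : 4 ≤ k) (hkeven : Even k) (ha : 0 < a) (hb : 0 < b)
    (hab : Nat.Coprime a b)
    (f : Module.Basis (Fin (dimModForms (k + 2) (a * b))) ℂ (ModForms (k + 2) (a * b)))
    (h : Module.Basis (Fin (dimModForms (k + 4) (a * b))) ℂ (ModForms (k + 4) (a * b))) :
    (∃ γ : Fin (dimModForms (k + 4) (a * b)) → ℂ, ∀ n : ℕ, 2 ≤ n →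
      (convWPow a b 1 1 (k - 1) n : ℂ) =
        (6 * (n : ℂ) ^ 2 - a * (k + 1) * n) / (12 * (a : ℂ) ^ 2 * (k + 1) * (k + 2))
            * sigmaDiv (k - 1) n b
          + (bernoulli k : ℂ) / (2 * a * (k + 2)) * n * sigmaDiv 1 n a
          + 2 * n / (a * (k + 2)) * convW a b 1 (k - 1) n
          + (bernoulli k : ℂ) / (4 * (a : ℂ) ^ 2 * k * (k + 1) * (k + 2))
            * ∑ i, γ i * modFormCoeff (h i) n) ∧
    (∃ α : Fin (dimModForms (k + 2) (a * b)) → ℂ, ∀ n : ℕ, 1 ≤ n →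
      (convW a b 1 (k - 1) n : ℂ) =
        (bernoulli k : ℂ) / (2 * k) * sigmaDiv 1 n a
          + (1 / 24 - (n : ℂ) / (2 * k * a)) * sigmaDiv (k - 1) n b
          - (bernoulli k : ℂ) / (4 * a * (k : ℂ) ^ 2) * ∑ i, α i * modFormCoeff (f i) n) := by
  have : NeZero a := ⟨ha.ne'⟩
  have : NeZero b := ⟨hb.ne'⟩
  have hk3 : 3 ≤ k := by omega
  have hk0 : k ≠ 0 := by omega
  have hφ := (isGamma0Form_scaledE2_sub (a := a)).of_dvd (dvd_mul_right a b)
  have hg := (isGamma0Form_scaledE (b := b) hk3).of_dvd (dvd_mul_left b a)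
  have qφ := hasQExpansion_scaledE2 (a := a)
  have qg := hasQExpansion_scaledE (b := b) hk3 hkeven
  obtain ⟨α, hα⟩ := (isGamma0Form_mul_add_deriv hk0 hφ hg).exists_sum_basis_eq
    (((qφ.mul qg).const_smul _).add (qg.normalizedDeriv.const_smul _)) f
  obtain ⟨γ, hγ⟩ := (isGamma0Form_bracket mdifferentiable_scaledE2 hφ hg).exists_sum_basis_eq
    (((qφ.normalizedDeriv.mul qg).const_smul _).add
      (((qφ.mul qg).normalizedDeriv.const_smul _).add
        (qg.normalizedDeriv.normalizedDeriv.const_smul _))) h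
  have hB : (bernoulli k : ℂ) ≠ 0 := by exact_mod_cast bernoulli_ne_zero_of_even hk0 hkeven
  have hkC : (k : ℂ) ≠ 0 := Nat.cast_ne_zero.mpr hk0
  have hk1 : (k + 1 : ℂ) ≠ 0 := by exact_mod_cast k.succ_ne_zero
  have hk2 : (k + 2 : ℂ) ≠ 0 := by exact_mod_cast (k + 1).succ_ne_zero
  have haC : (a : ℂ) ≠ 0 := Nat.cast_ne_zero.mpr ha.ne'
  -- The convolution sums enter with the factor (−24)(−2k/B_k) = 48k/B_k; 1/12 and −k/12 convert its
  -- inverse to the normalizations of the statement.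
  refine ⟨⟨fun i ↦ 12⁻¹ * γ i, fun n hn ↦ ?_⟩, ⟨fun i ↦ -(k / 12) * α i, fun n hn ↦ ?_⟩⟩
  · have hn0 : 0 < n := by omega
    have key := hγ n
    simp only [Pi.add_apply, Pi.smul_apply, smul_eq_mul,
      sum_antidiagonal_mul_eisensteinCoeff_mul ha hb,
      sum_antidiagonal_eisensteinCoeff_mul ha hb _ _ _ _ hn0,
      eisensteinCoeff_of_pos _ _ _ hn0] at key
    simp only [mul_assoc (12⁻¹ : ℂ), ← Finset.mul_sum]
    rw [← key]
    field_simp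
    ring
  · have key := hα n
    simp only [Pi.add_apply, Pi.smul_apply, smul_eq_mul, mul_eisensteinCoeff,
      sum_antidiagonal_eisensteinCoeff_mul ha hb _ _ _ _ hn] at key
    simp only [mul_assoc (-((k : ℂ) / 12)), ← Finset.mul_sum]
    rw [← key]
    field_simp
    ring
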